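/- All graphs are finite, simple and undirected. Let $G$ be a graph. For distinct nonadjacent vertices $x,y$ of $G$, an $x$-$y$ vertex cut is a set $S\subseteq V(G)\setminus\{x,y\}$ such that $x$ and $y$ lie in different components of $G-S$. A vertex-coloring $\tau$ of $G$ (not necessarily proper) is an MVD-coloring if for any two distinct nonadjacent vertices $x,y$ there is an $x$-$y$ vertex cut all of whose vertices have the same color. Let $\mathrm{mvd}(G)$ be the maximum number of colors used by an MVD-coloring of $G$. A graph is 2-connected if it has at least three vertices, is connected, and remains connected after the deletion of any one vertex; it is minimally 2-connected if it is 2-connected but $G-e$ is not 2-connected for every edge $e\in E(G)$. Theorem. If $G$ is a minimally 2-connected graph of order $n\ge 4$, then $\mathrm{mvd}(G)\le\lfloor n/2\rfloor$. The bound is attained by cycles: every cycle of order $n\ge 4$ is minimally 2-connected and satisfies $\mathrm{mvd}(G)=\lfloor n/2\rfloor$. -/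

import Mathlib

namespace SimpleGraph

/-- `G` is `k`-connected: it has more than `k` vertices, and deleting fewer than `k` vertices
always leaves a connected graph. -/
def IsVertexConnected {V : Type*} [Fintype V] (G : SimpleGraph V) (k : ℕ) : Prop :=
  k < Fintype.card V ∧
    ∀ S : Finset V, S.card < k → (G.induce {v | v ∉ S}).Connected

/-- `G` is minimally `2`-connected: it is `2`-connected, but deleting any edge destroys this. -/
def IsMinimallyTwoConnected {V : Type*} [Fintype V] (G : SimpleGraph V) : Prop :=
  G.IsVertexConnected 2 ∧ ∀ e ∈ G.edgeSet, ¬ (G.deleteEdges {e}).IsVertexConnected 2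

/-- `S` is an `x`-`y` vertex cut of `G`: a set of vertices that contains neither `x` nor `y`,
such that `x` and `y` lie in different components of `G - S`. -/
def IsVertexCut {V : Type*} (G : SimpleGraph V) (x y : V) (S : Set V) : Prop :=
  ∃ (hx : x ∉ S) (hy : y ∉ S), ¬ (G.induce {v | v ∉ S}).Reachable ⟨x, hx⟩ ⟨y, hy⟩

/-- All vertices of `S` have the same color under `τ`. -/
def IsMonochromatic {V C : Type*} (τ : V → C) (S : Set V) : Prop :=
  ∀ u ∈ S, ∀ v ∈ S, τ u = τ v

/-- `τ` is an MVD-coloring of `G`: any two distinct nonadjacent vertices are separated by a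
monochromatic vertex cut. -/
def IsMVDColoring {V C : Type*} (G : SimpleGraph V) (τ : V → C) : Prop :=
  ∀ x y : V, x ≠ y → ¬ G.Adj x y → ∃ S : Set V, IsMonochromatic τ S ∧ G.IsVertexCut x y S

/-- The monochromatic vertex-disconnection number: the maximum number of colors used by an
MVD-coloring of `G` (the maximum exists for finite `G`, see `isGreatest_mvd`). -/
noncomputable def mvd {V : Type*} (G : SimpleGraph V) : ℕ :=
  sSup {k : ℕ | ∃ τ : V → ℕ, G.IsMVDColoring τ ∧ (Set.range τ).ncard = k}

theorem isVertexCut_compl_pair {V : Type*} (G : SimpleGraph V) {x y : V} (hne : x ≠ y)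
    (hadj : ¬ G.Adj x y) : G.IsVertexCut x y {v | v ≠ x ∧ v ≠ y} := by
  refine ⟨by simp, by simp, ?_⟩
  intro hr
  obtain ⟨p⟩ := hr
  have hp := p.adj_snd (Walk.not_nil_of_ne fun h => hne (congrArg Subtype.val h))
  obtain ⟨⟨z, hz⟩, hxz⟩ : ∃ w, (G.induce {v | v ∉ {v | v ≠ x ∧ v ≠ y}}).Adj ⟨x, _⟩ w := ⟨_, hp⟩
  have hxz' : G.Adj x z := hxz
  have hz' : z = x ∨ z = y := by
    by_contra hcon
    push Not at hcon
    exact hz hcon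
  rcases hz' with rfl | rfl
  · exact G.loopless.irrefl _ hxz'
  · exact hadj hxz'

theorem isGreatest_mvd {V : Type*} [Fintype V] (G : SimpleGraph V) :
    IsGreatest {k : ℕ | ∃ τ : V → ℕ, G.IsMVDColoring τ ∧ (Set.range τ).ncard = k} G.mvd := by
  have hb : BddAbove {k : ℕ | ∃ τ : V → ℕ, G.IsMVDColoring τ ∧ (Set.range τ).ncard = k} := by
    refine ⟨Fintype.card V, ?_⟩
    rintro k ⟨τ, -, rfl⟩
    rw [← Set.image_univ, ← Nat.card_eq_fintype_card, ← Set.ncard_univ]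
    exact Set.ncard_image_le
  refine ⟨Nat.sSup_mem ⟨_, fun _ => 0, ?_, rfl⟩ hb, fun k hk => le_csSup hb hk⟩
  exact fun x y hne hadj => ⟨_, fun _ _ _ _ => rfl, G.isVertexCut_compl_pair hne hadj⟩

end SimpleGraph

/-! Upper bound: no color is used exactly once. Minimality gives each vertex `v` two nonadjacent
neighbors `x`, `y` (`exists_nonadj_neighbors`). Every `x`-`y` cut contains `v`, yet `{v}` is no cut
because `G - v` is connected, so a monochromatic cut repeats the color of `v`. Cycles: number the
vertices cyclically and color position `i` by `i` mod `m`, where `m = ⌊n/2⌋`. Positions `m` apart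
share a color, and some such pair separates any two nonadjacent vertices. -/

namespace SimpleGraph

/-! ### Reachability under maps and edge deletion -/

/-- A map sending edges to reachable pairs sends reachable pairs to reachable pairs. -/
theorem Reachable.map_of_adj {V W : Type*} {G : SimpleGraph V} {H : SimpleGraph W} (f : V → W)
    (hf : ∀ a b, G.Adj a b → H.Reachable (f a) (f b)) {u v : V} (h : G.Reachable u v) :
    H.Reachable (f u) (f v) := by
  obtain ⟨p⟩ := h
  induction p with
  | nil => exact Reachable.refl _
  | cons hadj _ ih => exact (hf _ _ hadj).trans ih

/-- A set that is closed under adjacency is closed under reachability. -/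
theorem Reachable.mem_of_adj_closed {V : Type*} {G : SimpleGraph V} {A : Set V}
    (hA : ∀ a b, G.Adj a b → a ∈ A → b ∈ A) {u v : V} (h : G.Reachable u v) (hu : u ∈ A) :
    v ∈ A := by
  obtain ⟨p⟩ := h
  induction p with
  | nil => exact hu
  | cons hadj _ ih => exact ih (hA _ _ hadj hu)

variable {V : Type*}

/-- Walks are rerouted around the deleted edge; if an end of it lies outside `T`, nothing is lost
and the hypothesis is vacuous. -/
theorem Connected.induce_deleteEdges {G : SimpleGraph V} {T : Set V} {a b : V}
    (hG : (G.induce T).Connected)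
    (hab : ∀ (ha : a ∈ T) (hb : b ∈ T),
      ((G.deleteEdges {s(a, b)}).induce T).Reachable ⟨a, ha⟩ ⟨b, hb⟩) :
    ((G.deleteEdges {s(a, b)}).induce T).Connected := by
  refine (connected_iff _).2 ⟨fun u v => ?_, hG.nonempty⟩
  refine (hG.preconnected u v).map_of_adj id ?_
  rintro ⟨c, hc⟩ ⟨d, hd⟩ hcd
  have hcd' : G.Adj c d := hcd
  by_cases he : s(c, d) = s(a, b)
  · rcases Sym2.eq_iff.1 he with ⟨rfl, rfl⟩ | ⟨rfl, rfl⟩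
    · exact hab hc hd
    · exact (hab hd hc).symm
  · exact Adj.reachable (show (G.deleteEdges {s(a, b)}).Adj c d by simp [deleteEdges_adj, hcd', he])

theorem reachable_induce_of_common_adj {G : SimpleGraph V} {T : Set V} {a b z : V}
    (ha : a ∈ T) (hb : b ∈ T) (hz : z ∈ T) (haz : G.Adj a z) (hzb : G.Adj z b) :
    (G.induce T).Reachable ⟨a, ha⟩ ⟨b, hb⟩ :=
  (Adj.reachable (show (G.induce T).Adj ⟨a, ha⟩ ⟨z, hz⟩ from haz)).trans
    (Adj.reachable (show (G.induce T).Adj ⟨z, hz⟩ ⟨b, hb⟩ from hzb))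

theorem setOf_ne_eq_setOf_notMem_singleton (v : V) :
    {u | u ≠ v} = {u | u ∉ ({v} : Finset V)} := by
  ext
  simp

/-- If `v` has no neighbours besides `x` and `y`, then connections in `G - x` to the vertex `y`
survive the deletion of `v` and of the edge `xy`. -/
theorem reachable_deleteEdges_of_fold {G : SimpleGraph V} {v x y z : V} (hxy : x ≠ y) (hyv : y ≠ v)
    (hN : ∀ u, G.Adj v u → u = x ∨ u = y) (hz : z ≠ v) (hzx : z ≠ x)
    (hG : (G.induce {u | u ≠ x}).Connected) :
    ((G.deleteEdges {s(x, y)}).induce {u | u ≠ v}).Reachable ⟨z, hz⟩ ⟨y, hyv⟩ := by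
  classical
  -- Fold `v` onto `y`, its only possible neighbor in `G - x`. Edges at `v` collapse, and the others
  -- avoid `x`, so none is the deleted edge.
  let f : {u | u ≠ x} → {u | u ≠ v} := fun u => if h : u.1 = v then ⟨y, hyv⟩ else ⟨u.1, h⟩
  have hf := (hG.preconnected ⟨z, hzx⟩ ⟨y, hxy.symm⟩).map_of_adj
    (H := (G.deleteEdges {s(x, y)}).induce {u | u ≠ v}) f ?_
  · simpa [f, hz, hyv] using hf
  · rintro ⟨a, ha⟩ ⟨b, hb⟩ hab
    have hab' : G.Adj a b := hab
    by_cases hav : a = v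
    · subst hav
      obtain rfl := (hN b hab').resolve_left hb
      simp [f, hyv]
    · by_cases hbv : b = v
      · subst hbv
        obtain rfl := (hN a hab'.symm).resolve_left ha
        simp [f, hyv]
      · simp only [f, hav, hbv, dite_false]
        refine Adj.reachable (show (G.deleteEdges {s(x, y)}).Adj a b from ?_)
        simp only [Set.mem_ofPred_eq] at ha hb
        simp [deleteEdges_adj, hab', ha, hb]

theorem IsVertexCut.symm {G : SimpleGraph V} {x y : V} {S : Set V} (h : G.IsVertexCut x y S) :
    G.IsVertexCut y x S := by
  obtain ⟨hx, hy, h⟩ := h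
  exact ⟨hy, hx, fun h' => h h'.symm⟩

variable [Fintype V] {G : SimpleGraph V}

/-! ### 2-connectivity -/

theorem IsVertexConnected.connected_induce_ne (hG : G.IsVertexConnected 2) (v : V) :
    (G.induce {u | u ≠ v}).Connected := by
  rw [setOf_ne_eq_setOf_notMem_singleton]
  exact hG.2 {v} (by simp)

theorem isVertexConnected_two_iff : G.IsVertexConnected 2 ↔
    2 < Fintype.card V ∧ G.Connected ∧ ∀ v, (G.induce {u | u ≠ v}).Connected := by
  constructor
  · intro h
    refine ⟨h.1, ?_, h.connected_induce_ne⟩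
    have h0 := h.2 ∅ (by simp)
    have : Nonempty V := Fintype.card_pos_iff.1 (by have := h.1; omega)
    refine (connected_iff _).2 ⟨fun u v => ?_, inferInstance⟩
    exact (h0.preconnected ⟨u, by simp⟩ ⟨v, by simp⟩).map_of_adj Subtype.val
      fun a b hab => Adj.reachable hab
  · rintro ⟨h1, h2, h3⟩
    refine ⟨h1, fun S hS => ?_⟩
    have : S.card = 0 ∨ S.card = 1 := by omega
    rcases this with h | h
    · rw [Finset.card_eq_zero] at h
      subst h
      have := h2.nonempty
      refine (connected_iff _).2 ⟨fun u v => ?_, ⟨⟨Classical.arbitrary V, by simp⟩⟩⟩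
      exact (h2.preconnected u.1 v.1).map_of_adj (fun w => (⟨w, by simp⟩ : {v | v ∉ (∅ : Finset V)}))
        fun a b hab => Adj.reachable hab
    · obtain ⟨v, rfl⟩ := Finset.card_eq_one.1 h
      rw [← setOf_ne_eq_setOf_notMem_singleton]
      exact h3 v

/-- Deleting an edge of a `2`-connected graph leaves it `2`-connected if the ends of the edge stay
joined after the deletion of any other vertex. -/
theorem IsVertexConnected.deleteEdges {a b : V} (hG : G.IsVertexConnected 2)
    (h : ∀ w, ∀ (ha : a ≠ w) (hb : b ≠ w),
      ((G.deleteEdges {s(a, b)}).induce {u | u ≠ w}).Reachable ⟨a, ha⟩ ⟨b, hb⟩) :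
    (G.deleteEdges {s(a, b)}).IsVertexConnected 2 := by
  rw [isVertexConnected_two_iff] at hG ⊢
  classical
  have key : ∀ w, ((G.deleteEdges {s(a, b)}).induce {u | u ≠ w}).Connected := fun w =>
    (hG.2.2 w).induce_deleteEdges fun ha hb => h w ha hb
  refine ⟨hG.1, ?_, key⟩
  have := hG.2.1.nonempty
  refine (connected_iff _).2 ⟨fun u v => ?_, inferInstance⟩
  -- Deleting a third vertex `w` already leaves `u` and `v` joined.
  obtain ⟨w, hw⟩ : ∃ w, w ∉ ({u, v} : Finset V) := by
    by_contra hcon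
    push Not at hcon
    have h1 := Finset.card_le_card (fun x _ => hcon x : (Finset.univ : Finset V) ⊆ {u, v})
    have h2 := Finset.card_le_two (a := u) (b := v)
    rw [Finset.card_univ] at h1
    have := hG.1
    omega
  simp only [Finset.mem_insert, Finset.mem_singleton, not_or] at hw
  exact ((key w).preconnected ⟨u, Ne.symm hw.1⟩ ⟨v, Ne.symm hw.2⟩).map_of_adj Subtype.val
    fun c d hcd => Adj.reachable hcd

theorem IsVertexConnected.exists_adj_ne (hG : G.IsVertexConnected 2) (v w : V) (hvw : v ≠ w) :
    ∃ x, x ≠ w ∧ G.Adj v x := by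
  classical
  obtain ⟨z, hz⟩ : ∃ z, z ∉ ({v, w} : Finset V) := by
    by_contra hcon
    push Not at hcon
    have h1 := Finset.card_le_card (fun x _ => hcon x : (Finset.univ : Finset V) ⊆ {v, w})
    have h2 := Finset.card_le_two (a := v) (b := w)
    rw [Finset.card_univ] at h1
    have := hG.1
    omega
  simp only [Finset.mem_insert, Finset.mem_singleton, not_or] at hz
  obtain ⟨p⟩ := (hG.connected_induce_ne w).preconnected ⟨v, hvw⟩ ⟨z, hz.2⟩
  cases p with
  | nil => exact absurd rfl hz.1
  | @cons _ x _ hadj _ => exact ⟨x.1, x.2, hadj⟩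

/-! ### The upper bound -/

/-- If the neighbors of `v` formed a clique, some edge could be deleted: `xy` when `x`, `y` are the
only neighbors, `vx` when there are more. -/
theorem IsMinimallyTwoConnected.exists_nonadj_neighbors (hG : G.IsMinimallyTwoConnected)
    (hn : 4 ≤ Fintype.card V) (v : V) :
    ∃ x y, G.Adj v x ∧ G.Adj v y ∧ x ≠ y ∧ ¬ G.Adj x y := by
  classical
  by_contra! hcl
  have h2 := hG.1
  have : Nontrivial V := Fintype.one_lt_card_iff_nontrivial.1 (by omega)
  obtain ⟨w, hw⟩ := exists_ne v
  obtain ⟨x, -, hvx⟩ := h2.exists_adj_ne v w hw.symm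
  obtain ⟨y, hyx, hvy⟩ := h2.exists_adj_ne v x hvx.ne
  have hxy := hcl x y hvx hvy hyx.symm
  by_cases hN : ∀ u, G.Adj v u → u = x ∨ u = y
  · refine hG.2 s(x, y) hxy (h2.deleteEdges fun w hxw hyw => ?_)
    by_cases hwv : w = v
    · subst hwv
      -- The path through `v` is lost here; a fourth vertex `z`, joined to both `x` and `y`,
      -- replaces it.
      obtain ⟨z, hz⟩ : ∃ z, z ∉ ({w, x, y} : Finset V) := by
        by_contra hcon
        push Not at hcon
        have h1 := Finset.card_le_card (fun x _ => hcon x : (Finset.univ : Finset V) ⊆ {w, x, y})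
        have h2 := Finset.card_le_three (a := w) (b := x) (c := y)
        rw [Finset.card_univ] at h1
        omega
      simp only [Finset.mem_insert, Finset.mem_singleton, not_or] at hz
      have hy := reachable_deleteEdges_of_fold hyx.symm hyw hN hz.1 hz.2.1
        (h2.connected_induce_ne x)
      have hx := reachable_deleteEdges_of_fold hyx hxw (fun u hu => (hN u hu).symm) hz.1 hz.2.2
        (h2.connected_induce_ne y)
      rw [Sym2.eq_swap] at hx
      exact hx.symm.trans hy
    · refine reachable_induce_of_common_adj hxw hyw (z := v) (Ne.symm hwv) ?_ ?_
      · simp [deleteEdges_adj, hvx.symm, hvy.ne, hvx.ne]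
      · simp [deleteEdges_adj, hvy, hvx.ne, hvy.ne]
  · push Not at hN
    obtain ⟨u, hvu, hux, huy⟩ := hN
    refine hG.2 s(v, x) hvx (h2.deleteEdges fun w hvw hxw => ?_)
    -- `u` and `y` are both common neighbors of `v` and `x`, and one of them differs from `w`.
    obtain ⟨z, hzw, hvz, hzx⟩ : ∃ z, z ≠ w ∧ G.Adj v z ∧ z ≠ x := by
      by_cases h : u = w
      · exact ⟨y, fun h' => huy (h.trans h'.symm), hvy, hyx⟩
      · exact ⟨u, h, hvu, hux⟩
    refine reachable_induce_of_common_adj hvw hxw (z := z) hzw ?_ ?_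
    · simp [deleteEdges_adj, hvz, hzx, hvx.ne]
    · simp [deleteEdges_adj, hcl z x hvz hvx hzx, hzx, hvz.ne.symm]

/-- In an MVD-coloring of a minimally `2`-connected graph of order at least `4` no color is used
only once. -/
theorem IsMVDColoring.exists_ne_eq {C : Type*} {τ : V → C} (hτ : G.IsMVDColoring τ)
    (hG : G.IsMinimallyTwoConnected) (hn : 4 ≤ Fintype.card V) (v : V) :
    ∃ u, u ≠ v ∧ τ u = τ v := by
  obtain ⟨x, y, hvx, hvy, hxy, hnadj⟩ := hG.exists_nonadj_neighbors hn v
  obtain ⟨S, hS, hxS, hyS, hcut⟩ := hτ x y hxy hnadj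
  have hvS : v ∈ S := by
    by_contra hvS
    exact hcut (reachable_induce_of_common_adj hxS hyS hvS hvx.symm hvy)
  by_contra! hcon
  have hSv : ∀ u ∈ S, u = v := fun u hu => by
    by_contra huv
    exact hcon u huv (hS u hu v hvS)
  refine hcut ?_
  let f : {u | u ≠ v} → {u | u ∉ S} := fun u => ⟨u.1, fun h => u.2 (hSv _ h)⟩
  exact ((hG.1.connected_induce_ne v).preconnected ⟨x, hvx.ne.symm⟩ ⟨y, hvy.ne.symm⟩).map_of_adj f
    fun a b hab => Adj.reachable hab

theorem IsMinimallyTwoConnected.mvd_le (hG : G.IsMinimallyTwoConnected)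
    (hn : 4 ≤ Fintype.card V) : G.mvd ≤ Fintype.card V / 2 := by
  classical
  obtain ⟨τ, hτ, hcard⟩ := G.isGreatest_mvd.1
  rw [← hcard, Nat.le_div_iff_mul_le two_pos, ← Set.image_univ, ← Finset.coe_univ,
    ← Finset.coe_image, Set.ncard_coe_finset, mul_comm, ← Finset.card_univ]
  refine Finset.mul_card_image_le_card _ 2 fun c hc => ?_
  obtain ⟨v, -, rfl⟩ := Finset.mem_image.1 hc
  obtain ⟨u, huv, hu⟩ := hτ.exists_ne_eq hG hn v
  exact Finset.one_lt_card.2 ⟨u, by simp [hu], v, by simp, huv⟩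

/-! ### Cycles -/

open scoped Fin.CommRing Fin.NatCast in
theorem isMinimallyTwoConnected_of_iso_cycleGraph {n : ℕ} (φ : G ≃g cycleGraph (n + 4)) :
    G.IsMinimallyTwoConnected := by
  have hcard : Fintype.card V = n + 4 := by simpa using Fintype.card_congr φ.toEquiv
  have hadj : ∀ a b, G.Adj (φ.symm a) (φ.symm b) ↔ a - b = 1 ∨ b - a = 1 := fun a b => by
    rw [φ.symm.map_adj_iff, cycleGraph_adj]
  have hsurj : ∀ v, ∃ a, φ.symm a = v := φ.symm.surjective
  have hinj : ∀ a b, φ.symm a = φ.symm b ↔ a = b := fun a b => φ.symm.injective.eq_iff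
  -- This makes the two neighbors `u + 1` and `u - 1` distinct.
  have h11 : (1 : Fin (n + 4)) + 1 ≠ 0 := by
    rw [Ne, Fin.ext_iff, Fin.val_add, Fin.val_one]
    have := Nat.mod_eq_of_lt (show 1 + 1 < n + 4 by omega)
    simp [this]
  constructor
  · rw [isVertexConnected_two_iff]
    refine ⟨by omega, φ.connected_iff.2 cycleGraph_connected, fun v => ?_⟩
    obtain ⟨w, rfl⟩ := hsurj v
    have hne : ∀ k : ℕ, k + 1 < n + 4 → φ.symm (w + ((k + 1 : ℕ) : Fin (n + 4))) ≠ φ.symm w := by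
      intro k hk h
      rw [hinj, add_eq_left, Fin.ext_iff, Fin.val_natCast, Nat.mod_eq_of_lt hk] at h
      simp at h
    have hreach : ∀ (k : ℕ) (hk : k + 1 < n + 4),
        (G.induce {u | u ≠ φ.symm w}).Reachable ⟨_, hne 0 (by omega)⟩ ⟨_, hne k hk⟩ := by
      intro k
      induction k with
      | zero => intro _; exact Reachable.refl _
      | succ k ih =>
        intro hk
        refine (ih (by omega)).trans (Adj.reachable ?_)
        refine (hadj (w + ((k + 1 : ℕ) : Fin (n + 4))) (w + ((k + 1 + 1 : ℕ) : Fin (n + 4)))).2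
          (Or.inr ?_)
        push_cast
        ring
    have hall : ∀ u : {u | u ≠ φ.symm w},
        (G.induce {u | u ≠ φ.symm w}).Reachable ⟨_, hne 0 (by omega)⟩ u := by
      rintro ⟨u, hu⟩
      obtain ⟨a, rfl⟩ := hsurj u
      have ha : a - w ≠ 0 := fun h => hu (by rw [sub_eq_zero.1 h])
      obtain ⟨k, hk⟩ := Nat.exists_eq_succ_of_ne_zero (fun h => ha (Fin.ext h))
      have hlt := (a - w).isLt
      have := hreach k (by omega)
      have he : w + ((k + 1 : ℕ) : Fin (n + 4)) = a := by
        rw [show k + 1 = (a - w).val from hk.symm, Fin.cast_val_eq_self, add_sub_cancel]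
      simpa only [he] using this
    exact (connected_iff _).2 ⟨fun a b => (hall a).symm.trans (hall b), ⟨⟨_, hne 0 (by omega)⟩⟩⟩
  · intro e he h2
    induction e with
    | _ a b =>
    obtain ⟨u, rfl⟩ := hsurj a
    obtain ⟨v, rfl⟩ := hsurj b
    have huv : u - v = 1 ∨ v - u = 1 := (hadj u v).1 he
    -- `w` is the other neighbor of `u`. Without the edge `uv` it is the only one, contradicting
    -- `exists_adj_ne`.
    obtain ⟨w, hw, hwu, hN⟩ : ∃ w, w ≠ v ∧ w ≠ u ∧ ∀ z, (u - z = 1 ∨ z - u = 1) → z = v ∨ z = w := by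
      rcases huv with h | h
      · refine ⟨u + 1, fun h' => h11 ?_, by simp, ?_⟩
        · rw [← h'] at h
          linear_combination - h
        · rintro z (hz | hz)
          · left; linear_combination h - hz
          · right; linear_combination hz
      · refine ⟨u - 1, fun h' => h11 ?_, by simp [sub_eq_self], ?_⟩
        · rw [← h'] at h
          linear_combination - h
        · rintro z (hz | hz)
          · right; linear_combination - hz
          · left; linear_combination hz - h
    obtain ⟨z, hzw, hz⟩ := h2.exists_adj_ne (φ.symm u) (φ.symm w) (by rw [Ne, hinj]; exact hwu.symm)
    obtain ⟨c, rfl⟩ := hsurj z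
    rw [deleteEdges_adj, hadj] at hz
    rcases hN c hz.1 with rfl | rfl
    · exact hz.2 rfl
    · exact hzw rfl

theorem cycleGraph_adj_val {n : ℕ} {a b : Fin (n + 4)} (h : (cycleGraph (n + 4)).Adj a b) :
    a.val + 1 = b.val ∨ b.val + 1 = a.val ∨ (a.val = 0 ∧ b.val = n + 3) ∨
      (b.val = 0 ∧ a.val = n + 3) := by
  rw [cycleGraph_adj'] at h
  have ha := a.isLt
  have hb := b.isLt
  rcases h with h | h
  · rcases le_or_gt b a with hab | hab
    · rw [Fin.sub_val_of_le hab] at h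
      omega
    · rw [Fin.coe_sub_iff_lt.2 hab] at h
      omega
  · rcases le_or_gt a b with hab | hab
    · rw [Fin.sub_val_of_le hab] at h
      omega
    · rw [Fin.coe_sub_iff_lt.2 hab] at h
      omega

theorem cycleGraph_adj_of_val {n : ℕ} {a b : Fin (n + 4)}
    (h : a.val + 1 = b.val ∨ (a.val = 0 ∧ b.val = n + 3)) : (cycleGraph (n + 4)).Adj a b := by
  rw [cycleGraph_adj']
  have ha := a.isLt
  have hb := b.isLt
  have hab : a < b := by rw [Fin.lt_def]; omega
  rcases h with h | h
  · right
    rw [Fin.sub_val_of_le hab.le]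
    omega
  · left
    rw [Fin.coe_sub_iff_lt.2 hab]
    omega

/-- Two vertices of a cycle separate the two arcs between them. -/
theorem isVertexCut_of_iso_cycleGraph {n : ℕ} (φ : G ≃g cycleGraph (n + 4)) {x y : V} {a b : ℕ}
    (hb : b < n + 4) (hx : a < (φ x).val ∧ (φ x).val < b) (hy : (φ y).val < a ∨ b < (φ y).val) :
    G.IsVertexCut x y {v | (φ v).val = a ∨ (φ v).val = b} := by
  refine ⟨by simp only [Set.mem_ofPred_eq]; omega, by simp only [Set.mem_ofPred_eq]; omega,
    fun h => ?_⟩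
  -- The open arc between `a` and `b` is closed under adjacency: it contains neither position `0`
  -- nor `n + 3`, so the wrap-around edge misses it.
  have := h.mem_of_adj_closed 
    (A := {v : {v | v ∉ {v | (φ v).val = a ∨ (φ v).val = b}} | a < (φ v.1).val ∧ (φ v.1).val < b})
    ?_ hx
  · simp only [Set.mem_ofPred_eq] at this
    omega
  · rintro ⟨c, hc⟩ ⟨d, hd⟩ hcd hca
    have hcd' : G.Adj c d := hcd
    have := cycleGraph_adj_val (φ.map_adj_iff.2 hcd')
    have hc' := (φ c).isLt
    have hd' := (φ d).isLt
    simp only [Set.mem_ofPred_eq] at hc hd hca ⊢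
    omega

theorem isMVDColoring_of_iso_cycleGraph {n : ℕ} (φ : G ≃g cycleGraph (n + 4)) :
    G.IsMVDColoring fun v => (φ v).val % ((n + 4) / 2) := by
  obtain ⟨m, hm⟩ : ∃ m, m = (n + 4) / 2 := ⟨_, rfl⟩
  rw [← hm]
  have hmono : ∀ a b, b = a + m →
      IsMonochromatic (fun v => (φ v).val % m) {v | (φ v).val = a ∨ (φ v).val = b} := by
    rintro a _ rfl u (hu | hu) v (hv | hv) <;> simp [hu, hv]
  have key : ∀ x y, (φ x).val < (φ y).val → ¬ G.Adj x y →
      ∃ S : Set V, IsMonochromatic (fun v => (φ v).val % m) S ∧ G.IsVertexCut x y S := by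
    intro x y hlt hnadj
    rw [← φ.map_adj_iff] at hnadj
    have h1 : ¬ ((φ x).val + 1 = (φ y).val ∨ ((φ x).val = 0 ∧ (φ y).val = n + 3)) :=
      fun h => hnadj (cycleGraph_adj_of_val h)
    have hy := (φ y).isLt
    -- One cut vertex is placed next to `x` or `y`, the other `m` away, so that the arc from the
    -- lower to the higher holds exactly one of `x`, `y`. The subtractions never truncate; in the
    -- last case `y` is at `n + 3`, so nonadjacency puts `x` at position at least `1`.
    by_cases h2 : (φ y).val ≤ (φ x).val + m
    · by_cases h3 : (φ x).val + 1 + m < n + 4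
      · exact ⟨_, hmono ((φ x).val + 1) _ rfl,
          (isVertexCut_of_iso_cycleGraph φ (by omega) (by omega) (by omega)).symm⟩
      · exact ⟨_, hmono ((φ x).val + 1 - m) ((φ x).val + 1) (by omega),
          isVertexCut_of_iso_cycleGraph φ (by omega) (by omega) (by omega)⟩
    · by_cases h3 : (φ y).val + 1 < n + 4
      · exact ⟨_, hmono ((φ y).val + 1 - m) ((φ y).val + 1) (by omega),
          (isVertexCut_of_iso_cycleGraph φ (by omega) (by omega) (by omega)).symm⟩
      · exact ⟨_, hmono ((φ x).val - 1) _ rfl,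
          isVertexCut_of_iso_cycleGraph φ (by omega) (by omega) (by omega)⟩
  intro x y hne hnadj
  rcases lt_trichotomy (φ x).val (φ y).val with h | h | h
  · exact key x y h hnadj
  · exact absurd (φ.injective (Fin.ext h)) hne
  · obtain ⟨S, hS, hcut⟩ := key y x h fun h => hnadj h.symm
    exact ⟨S, hS, hcut.symm⟩

theorem le_mvd_of_iso_cycleGraph {n : ℕ} (φ : G ≃g cycleGraph (n + 4)) :
    (n + 4) / 2 ≤ G.mvd := by
  refine G.isGreatest_mvd.2 ⟨_, isMVDColoring_of_iso_cycleGraph φ, ?_⟩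
  have : Set.range (fun v => (φ v).val % ((n + 4) / 2)) =
      ((Finset.range ((n + 4) / 2) : Finset ℕ) : Set ℕ) := by
    ext k
    simp only [Set.mem_range, Finset.coe_range, Set.mem_Iio]
    constructor
    · rintro ⟨v, rfl⟩
      exact Nat.mod_lt _ (by omega)
    · intro hk
      exact ⟨φ.symm ⟨k, by omega⟩, by simp [Nat.mod_eq_of_lt hk]⟩
  rw [this, Set.ncard_coe_finset, Finset.card_range]

end SimpleGraph

theorem mainTheorem2 {V : Type*} [Fintype V] (G : SimpleGraph V) (hn : 4 ≤ Fintype.card V) :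
    (G.IsMinimallyTwoConnected → G.mvd ≤ Fintype.card V / 2) ∧
    (Nonempty (G ≃g SimpleGraph.cycleGraph (Fintype.card V)) →
      G.IsMinimallyTwoConnected ∧ G.mvd = Fintype.card V / 2) := by
  refine ⟨fun hG => hG.mvd_le hn, ?_⟩
  rintro ⟨φ⟩
  obtain ⟨n, hcard⟩ := Nat.exists_eq_add_of_le' hn
  rw [hcard] at φ
  have hG := SimpleGraph.isMinimallyTwoConnected_of_iso_cycleGraph φ
  refine ⟨hG, (hG.mvd_le hn).antisymm ?_⟩
  rw [hcard]
  exact SimpleGraph.le_mvd_of_iso_cycleGraph φ
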